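/- Conventions. A polytope $P\subset\mathbb R^n$ is the convex hull of finitely many points. It is decomposable if $P=Q+R$ (Minkowski sum) for polytopes $Q,R$ neither of which is homothetic to $P$, i.e. of the form $v+tP$ with $t>0$, $v\in\mathbb R^n$. It is proper if it has more than one point. A hyperplane $H$ is facet-defining for $P$ if it supports $P$ and $P\cap H$ is a facet of $P$. A polytope $P$ is 2-level if for every facet-defining hyperplane $H$ there is a hyperplane $H'$ parallel to $H$ such that all vertices of $P$ lie in $H\cup H'$. A polytope $P\subset\mathbb R^n$ is compressed if all its vertices lie in $\mathbb Z^n$ and for every facet-defining hyperplane $H$ there is at most one hyperplane $H'\neq H$ parallel to $H$ such that $H'\cap P$ contains a point of $\mathbb Z^n$. **Theorem 4.3.** Let $P\subset\mathbb R^n$ be a 2-level (resp. compressed) polytope. Then $P$ is decomposable if and only if $P$ is a product of 2-level (resp. compressed) polytopes, that is, if and only if $P$ is affinely isomorphic to a Cartesian product $P_1\times\cdots\times P_k$ of $k\ge2$ proper 2-level (resp. compressed) polytopes $P_i\subset\mathbb R^{m_i}$. Equivalently, $P$ is decomposable if and only if there are $k\ge 2$ and proper 2-level (resp. compressed, with respect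 to the same lattice $\mathbb Z^n$) polytopes $P_1,\dots,P_k\subset\mathbb R^n$ such that $(x_1,\dots,x_k)\mapsto x_1+\cdots+x_k$ restricts to a bijection from $P_1\times\cdots\times P_k$ onto $P$. -/

import Mathlib

open scoped Pointwise

namespace Polytope

section General

variable {V : Type*} [AddCommGroup V] [Module ℝ V]

/-- A (convex) polytope: the convex hull of a finite set of points. -/
def IsPolytope (P : Set V) : Prop :=
  ∃ s : Finset V, P = convexHull ℝ (s : Set V)

/-- `Q` is homothetic to `P`: it arises from `P` by a positive dilation and a translation. -/
def IsHomothetic (P Q : Set V) : Prop :=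
  ∃ (t : ℝ) (v : V), 0 < t ∧ Q = (fun x => v + t • x) '' P

/-- `P` is (Minkowski) decomposable: it is the Minkowski sum of two polytopes neither of which
is homothetic to `P`. -/
def IsDecomposable (P : Set V) : Prop :=
  ∃ Q R : Set V, IsPolytope Q ∧ IsPolytope R ∧ P = Q + R ∧
    ¬ IsHomothetic P Q ∧ ¬ IsHomothetic P R

/-- The dimension of a set, that is, of its affine span. -/
noncomputable def dim (P : Set V) : ℕ :=
  Module.finrank ℝ (vectorSpan ℝ P)

/-- `H = {x | a x = b}` is a facet-defining hyperplane of `P`: it is a hyperplane, it supports `P`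
(it meets `P`, and `P` lies on one side of it), and the face `P ∩ H` is a facet. -/
def IsFacetHyperplane (P : Set V) (a : V →ₗ[ℝ] ℝ) (b : ℝ) : Prop :=
  a ≠ 0 ∧ (∀ x ∈ P, a x ≤ b) ∧ (P ∩ {x | a x = b}).Nonempty ∧
    dim (P ∩ {x | a x = b}) + 1 = dim P

/-- `P` is a 2-level polytope: for every facet-defining hyperplane `H = {x | a x = b}` there is a
parallel hyperplane `H' = {x | a x = c}` such that all vertices of `P` lie in `H ∪ H'`. -/
def IsTwoLevel (P : Set V) : Prop :=
  IsPolytope P ∧ ∀ (a : V →ₗ[ℝ] ℝ) (b : ℝ), IsFacetHyperplane P a b →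
    ∃ c : ℝ, ∀ v ∈ P.extremePoints ℝ, a v = b ∨ a v = c

/-- `P` is the internal product of at least two proper sets (sets with more than one point) with
the property `Φ`: the addition map restricts to an affine isomorphism from the Cartesian
product of these sets onto `P`. -/
def IsInternalProductOf (Φ : Set V → Prop) (P : Set V) : Prop :=
  ∃ k : ℕ, 2 ≤ k ∧ ∃ Q : Fin k → Set V, (∀ i, (Q i).Nontrivial ∧ Φ (Q i)) ∧
    Set.BijOn (fun x : Fin k → V => ∑ i, x i) (Set.univ.pi Q) P

end General

/-- The lattice `ℤⁿ` in `ℝⁿ`. -/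
def IsLatticePoint {n : ℕ} (x : Fin n → ℝ) : Prop :=
  ∀ i, ∃ z : ℤ, x i = z

/-- A lattice polytope: a polytope all of whose vertices are lattice points. -/
def IsLatticePolytope {n : ℕ} (P : Set (Fin n → ℝ)) : Prop :=
  IsPolytope P ∧ ∀ v ∈ P.extremePoints ℝ, IsLatticePoint v

/-- `P` is a compressed polytope: it is a lattice polytope, and for every facet-defining
hyperplane `H = {x | a x = b}` there is at most one hyperplane `H' = {x | a x = c}` parallel to and
different from `H` such that `H' ∩ P` contains a lattice point. -/
def IsCompressed {n : ℕ} (P : Set (Fin n → ℝ)) : Prop :=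
  IsLatticePolytope P ∧
    ∀ (a : (Fin n → ℝ) →ₗ[ℝ] ℝ) (b : ℝ), IsFacetHyperplane P a b →
      {c : ℝ | c ≠ b ∧ ∃ x ∈ P, IsLatticePoint x ∧ a x = c}.Subsingleton

/-- `P` is affinely isomorphic to a Cartesian product of at least two proper sets (sets with
more than one point) with the property `Φ`, each living in some `ℝᵐ`: an affine map restricts to a
bijection from the Cartesian product onto `P`. -/
def IsProductOf (Φ : ∀ m : ℕ, Set (Fin m → ℝ) → Prop) {n : ℕ} (P : Set (Fin n → ℝ)) : Prop :=
  ∃ k : ℕ, 2 ≤ k ∧ ∃ (m : Fin k → ℕ) (Q : ∀ i, Set (Fin (m i) → ℝ)),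
    (∀ i, (Q i).Nontrivial ∧ Φ (m i) (Q i)) ∧
    ∃ g : (∀ i, Fin (m i) → ℝ) →ᵃ[ℝ] (Fin n → ℝ), Set.BijOn g (Set.univ.pi Q) P

end Polytope

/-!
A product `A + B` of two proper polytopes is decomposable: if `A` were homothetic to `A + B`, it
would contain a segment parallel to a segment of `B`, so the sum map would not be injective
(`Polytope.not_isHomothetic_add`). For the converse, let `P = Q + R` be 2-level, with neither summand
homothetic to `P`, let `L` be the direction of the affine span of `P`, and write each vertex `u` of
`P` as `q u + r u`.

A vertex of `P` lies in a given facet `a = b` or in the opposite face, and then `q u` maximizes or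
minimizes `a` on `Q`. Hence `a (q u - q v) = μ a * a (u - v)` for a constant `μ a` and all
vertices `u`, `v` (`Polytope.IsTwoLevel.exists_scale`). Since facet functionals separate the points
of `L` and differences of vertices span `L`, the map `u - v ↦ q u - q v` comes from an
endomorphism `T` of `L` with `a ∘ T = μ a • a` for every facet functional `a`. So `T` is
diagonalizable. If all `μ a` coincide, `q` is a homothety on the vertices and one of the
summands is homothetic to `P` (`Polytope.IsPolytope.isHomothetic_of_scale`). Otherwise let `π` be
the projection of `L` onto an eigenspace of `T` along the others
(`Polytope.exists_eigenprojection`). Every facet functional factors through `π` or through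
`1 - π`; as `P` is cut out by its facet inequalities in its affine span
(`Polytope.IsPolytope.mem_of_facets`), `P` is the product of its images under `π` and `1 - π`
(`Polytope.IsTwoLevel.exists_splitting`).

These images inherit the property of `P`, because a facet of a factor gives a facet of `P` with the
same levels up to a shift (`Polytope.IsSplitting.isFacetHyperplane`). For lattice polytopes the copy of a factor
through a vertex of `P` has vertices of `P` as its vertices
(`Polytope.IsSplitting.mem_extremePoints`). A compressed polytope is 2-level, so both cases of the
theorem follow.
-/

namespace Polytope

/-! ### Polytopes and their faces -/

section Polytopes

variable {V : Type*} [AddCommGroup V] [Module ℝ V]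

theorem IsPolytope.convex {P : Set V} (hP : IsPolytope P) : Convex ℝ P := by
  obtain ⟨s, rfl⟩ := hP
  exact convex_convexHull ℝ _

theorem isPolytope_of_finite {s : Set V} (hs : s.Finite) : IsPolytope (convexHull ℝ s) :=
  ⟨hs.toFinset, by simp⟩

theorem IsPolytope.image {W : Type*} [AddCommGroup W] [Module ℝ W] {P : Set V}
    (hP : IsPolytope P) (f : V →ᵃ[ℝ] W) : IsPolytope (f '' P) := by
  obtain ⟨s, rfl⟩ := hP
  rw [f.image_convexHull]
  exact isPolytope_of_finite (s.finite_toSet.image f)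

theorem IsPolytope.pi {ι : Type*} [Finite ι] {E : ι → Type*} [∀ i, AddCommGroup (E i)]
    [∀ i, Module ℝ (E i)] {Q : ∀ i, Set (E i)} (hQ : ∀ i, IsPolytope (Q i)) :
    IsPolytope (Set.univ.pi Q) := by
  choose s hs using hQ
  have h : Set.univ.pi Q = convexHull ℝ (Set.univ.pi fun i => (s i : Set (E i))) := by
    rw [convexHull_pi]
    exact Set.pi_congr rfl fun i _ => hs i
  rw [h]
  exact isPolytope_of_finite (Set.Finite.pi fun i => (s i).finite_toSet)

theorem apply_eq_zero_of_mem_vectorSpan {P : Set V} {a : V →ₗ[ℝ] ℝ} {c : ℝ}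
    (h : ∀ x ∈ P, a x = c) {z : V} (hz : z ∈ vectorSpan ℝ P) : a z = 0 := by
  have : vectorSpan ℝ P ≤ LinearMap.ker a := by
    rw [vectorSpan_def, Submodule.span_le]
    rintro _ ⟨x, hx, y, hy, rfl⟩
    simp [h x hx, h y hy]
  exact this hz

theorem vectorSpan_face_le (P : Set V) (a : V →ₗ[ℝ] ℝ) (b : ℝ) :
    vectorSpan ℝ (P ∩ {x | a x = b}) ≤ vectorSpan ℝ P ⊓ LinearMap.ker a :=
  le_inf (vectorSpan_mono ℝ Set.inter_subset_left)
    fun _ hz => apply_eq_zero_of_mem_vectorSpan (fun _ hx => hx.2) hz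

/-- If the face cut out by a valid inequality `a ≤ b` violated at `x` is not a facet, then there is
another functional `c`, constant on the face and equal there to its value at `x`, which
takes a bigger value somewhere on `P`. -/
theorem exists_rotation {P : Set V} {a : V →ₗ[ℝ] ℝ} {b : ℝ} {x p : V} (hp : p ∈ P)
    (hap : a p = b) (hxb : b < a x)
    (hface : ¬ vectorSpan ℝ P ⊓ LinearMap.ker a ≤ vectorSpan ℝ (P ∩ {x | a x = b})) :
    ∃ c : V →ₗ[ℝ] ℝ, c x = c p ∧ (∀ y ∈ P, a y = b → c y = c p) ∧ ∃ y ∈ P, c p < c y := by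
  obtain ⟨z, hz, hzF⟩ := SetLike.not_le_iff_exists.1 hface
  obtain ⟨f, hfz, hf⟩ := Submodule.exists_le_ker_of_notMem hzF
  have hd : a (x - p) ≠ 0 := by rw [map_sub]; linarith
  -- Subtracting a multiple of `a` makes the functional vanish on `x - p`.
  set g : V →ₗ[ℝ] ℝ := f - (f (x - p) / a (x - p)) • a with hg
  have hgx : g (x - p) = 0 := by
    simp only [hg, LinearMap.sub_apply, LinearMap.smul_apply, smul_eq_mul]
    field_simp
    simp
  have hgF : ∀ y ∈ P, a y = b → g (y - p) = 0 := by
    intro y hy hyb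
    have h1 : f (y - p) = 0 := hf (vsub_mem_vectorSpan ℝ ⟨hy, hyb⟩ ⟨hp, hap⟩)
    have h2 : a (y - p) = 0 := by rw [map_sub, hyb, hap, sub_self]
    simp [hg, -map_sub, h1, h2]
  have hgz : g z ≠ 0 := by
    have : a z = 0 := hz.2
    simpa [hg, this] using hfz
  have hgy : ∃ y ∈ P, g y ≠ g p := by
    by_contra! h
    exact hgz (apply_eq_zero_of_mem_vectorSpan h hz.1)
  simp only [map_sub, sub_eq_zero] at hgx hgF
  obtain ⟨y, hy, hne⟩ := hgy
  rcases hne.lt_or_gt with h | h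
  · exact ⟨-g, by simp [hgx], fun y hy hyb => by simp [hgF y hy hyb], y, hy, by simpa using h⟩
  · exact ⟨g, hgx, hgF, y, hy, h⟩

theorem apply_le_of_mem_convexHull {s : Set V} {a : V →ₗ[ℝ] ℝ} {b : ℝ} (h : ∀ v ∈ s, a v ≤ b)
    {x : V} (hx : x ∈ convexHull ℝ s) : a x ≤ b :=
  convexHull_min (t := {y | a y ≤ b}) h (convex_halfSpace_le a.isLinear b) hx

end Polytopes

/-! ### The facet description of a polytope -/

section Facets

variable {V : Type*} [AddCommGroup V] [Module ℝ V] [FiniteDimensional ℝ V]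

theorem finrank_inf_ker_add_one {L : Submodule ℝ V} {a : V →ₗ[ℝ] ℝ} (h : ∃ z ∈ L, a z ≠ 0) :
    Module.finrank ℝ ↥(L ⊓ LinearMap.ker a) + 1 = Module.finrank ℝ L := by
  obtain ⟨z, hz, haz⟩ := h
  have h0 : a.domRestrict L ≠ 0 := fun h0 => haz (by
    simpa using LinearMap.congr_fun h0 (⟨z, hz⟩ : L))
  have h1 : (LinearMap.ker (a.domRestrict L)).map L.subtype = L ⊓ LinearMap.ker a := by
    ext x
    simp [and_comm]
  rw [← h1, Submodule.finrank_map_subtype_eq]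
  exact Module.Dual.finrank_ker_add_one_of_ne_zero h0

/-- Facets without dimension counts: a proper supporting hyperplane is facet-defining if the
direction of the face is as large as the hyperplane allows. -/
theorem isFacetHyperplane_iff {P : Set V} {a : V →ₗ[ℝ] ℝ} {b : ℝ} :
    IsFacetHyperplane P a b ↔ (∀ x ∈ P, a x ≤ b) ∧ (P ∩ {x | a x = b}).Nonempty ∧
      (∃ z ∈ vectorSpan ℝ P, a z ≠ 0) ∧
      vectorSpan ℝ P ⊓ LinearMap.ker a ≤ vectorSpan ℝ (P ∩ {x | a x = b}) := by
  constructor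
  · rintro ⟨_, hle, hne, hdim⟩
    have hz : ∃ z ∈ vectorSpan ℝ P, a z ≠ 0 := by
      by_contra! h
      obtain ⟨y, hy, hyb⟩ := hne
      have : P ∩ {x | a x = b} = P := by
        refine Set.inter_eq_left.2 fun x hx => ?_
        have := h (x - y) (vsub_mem_vectorSpan ℝ hx hy)
        rw [map_sub, sub_eq_zero] at this
        exact this.trans hyb
      rw [this] at hdim
      omega
    refine ⟨hle, hne, hz, (Submodule.eq_of_le_of_finrank_eq (vectorSpan_face_le P a b) ?_).ge⟩
    have := finrank_inf_ker_add_one hz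
    unfold dim at hdim
    omega
  · rintro ⟨hle, hne, hz, hL⟩
    refine ⟨?_, hle, hne, ?_⟩
    · rintro rfl
      simp at hz
    · unfold dim
      rw [(vectorSpan_face_le P a b).antisymm hL]
      exact finrank_inf_ker_add_one hz

/-- A point of the affine span that violates some valid and tight inequality violates the
inequality of a facet. The inequality is rotated about its face, still being violated, until the face
contains a further vertex; the induction is on the number `k` of vertices off the face. -/
theorem exists_facet_of_valid (s : Finset V) {x : V} (k : ℕ) :
    ∀ (a : V →ₗ[ℝ] ℝ) (b : ℝ), (∀ v ∈ s, a v ≤ b) → (∃ v ∈ s, a v = b) → b < a x →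
      (∀ p ∈ s, x - p ∈ vectorSpan ℝ (convexHull ℝ (s : Set V))) →
      (s.filter fun v => a v < b).card = k →
      ∃ a' b', IsFacetHyperplane (convexHull ℝ (s : Set V)) a' b' ∧ b' < a' x := by
  induction k using Nat.strong_induction_on with
  | _ k ih =>
  rintro a b hle ⟨p, hps, hpb⟩ hxb hx hk
  have hsub := subset_convexHull ℝ (s : Set V)
  by_cases hface : vectorSpan ℝ (convexHull ℝ (s : Set V)) ⊓ LinearMap.ker a ≤
      vectorSpan ℝ (convexHull ℝ (s : Set V) ∩ {x | a x = b})
  · refine ⟨a, b, isFacetHyperplane_iff.2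
      ⟨fun y hy => apply_le_of_mem_convexHull hle hy, ⟨p, hsub hps, hpb⟩,
        ⟨x - p, hx p hps, ?_⟩, hface⟩, hxb⟩
    rw [map_sub]
    linarith
  obtain ⟨c, hcx, hcF, y₀, hy₀, hcy₀⟩ := exists_rotation (hsub hps) hpb hxb hface
  obtain ⟨y₁, hy₁, hcy₁⟩ : ∃ y ∈ s, c p < c y := by
    by_contra! h
    exact absurd (apply_le_of_mem_convexHull h hy₀) hcy₀.not_ge
  -- Rotate until the first vertex `y` beyond the hyperplane `c = c p` becomes tight.
  obtain ⟨y, hy, hmin⟩ := (s.filter fun v => c p < c v).exists_min_image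
    (fun v => (b - a v) / (c v - c p)) ⟨y₁, by simp [hy₁, hcy₁]⟩
  simp only [Finset.mem_filter, and_imp] at hy hmin
  have hcy : 0 < c y - c p := sub_pos.2 hy.2
  set t := (b - a y) / (c y - c p) with ht
  have ht0 : 0 ≤ t := div_nonneg (sub_nonneg.2 (hle y hy.1)) hcy.le
  have hty : t * (c y - c p) = b - a y := div_mul_cancel₀ _ hcy.ne'
  have hvalid : ∀ v ∈ s, a v + t * c v ≤ b + t * c p := by
    intro v hv
    rcases le_or_gt (c v) (c p) with h | h
    · nlinarith [hle v hv, mul_le_mul_of_nonneg_left h ht0]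
    · have := (le_div_iff₀ (sub_pos.2 h)).1 (hmin v hv h)
      linarith
  refine ih _ ?_ (a + t • c) (b + t * c p) (by simpa using hvalid) ⟨p, hps, by simp [hpb]⟩
    (by simpa [hcx] using hxb) hx rfl
  rw [← hk]
  refine Finset.card_lt_card ⟨fun v hv => ?_, fun hsup => ?_⟩
  · simp only [Finset.mem_filter, LinearMap.add_apply, LinearMap.smul_apply, smul_eq_mul] at hv ⊢
    refine ⟨hv.1, lt_of_le_of_ne (hle v hv.1) fun h => ?_⟩
    rw [hcF v (hsub hv.1) h, h] at hv
    exact lt_irrefl _ hv.2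
  · have hyb : a y < b := lt_of_le_of_ne (hle y hy.1) fun h => by
      have := hcF y (hsub hy.1) h
      linarith
    have := hsup (Finset.mem_filter.2 ⟨hy.1, hyb⟩)
    simp only [Finset.mem_filter, LinearMap.add_apply, LinearMap.smul_apply, smul_eq_mul] at this
    linarith [this.2]

end Facets

section Normed

variable {V : Type*} [NormedAddCommGroup V] [NormedSpace ℝ V]

theorem IsPolytope.isCompact {P : Set V} (hP : IsPolytope P) : IsCompact P := by
  obtain ⟨s, rfl⟩ := hP
  exact s.finite_toSet.isCompact_convexHull ℝ

theorem IsPolytope.convexHull_extremePoints {P : Set V} (hP : IsPolytope P) :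
    convexHull ℝ (P.extremePoints ℝ) = P := by
  have hfin : (P.extremePoints ℝ).Finite := by
    obtain ⟨s, rfl⟩ := hP
    exact s.finite_toSet.subset extremePoints_convexHull_subset
  rw [← (hfin.isClosed_convexHull ℝ).closure_eq]
  exact closure_convexHull_extremePoints hP.isCompact hP.convex

variable [FiniteDimensional ℝ V]

/-- A polytope is cut out, within its affine span, by its facet-defining inequalities. -/
theorem IsPolytope.mem_of_facets {P : Set V} (hP : IsPolytope P) {p x : V} (hp : p ∈ P)
    (hx : x - p ∈ vectorSpan ℝ P) (h : ∀ a b, IsFacetHyperplane P a b → a x ≤ b) : x ∈ P := by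
  by_contra hxP
  obtain ⟨f, u, hfu, hux⟩ :=
    geometric_hahn_banach_closed_point hP.convex hP.isCompact.isClosed hxP
  obtain ⟨s, rfl⟩ := hP
  have hsub := subset_convexHull ℝ (s : Set V)
  have hs : s.Nonempty := by
    have := convexHull_nonempty_iff (𝕜 := ℝ).1 ⟨p, hp⟩
    exact_mod_cast this
  obtain ⟨v, hv, hmax⟩ := s.exists_max_image f hs
  obtain ⟨a, b, hab, hb⟩ := exists_facet_of_valid s _ (f : V →ₗ[ℝ] ℝ) (f v) hmax ⟨v, hv, rfl⟩
    ((hfu v (hsub hv)).trans hux) (fun q hq => by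
      have := Submodule.add_mem _ hx (vsub_mem_vectorSpan ℝ hp (hsub hq))
      simpa using this) rfl
  exact (h a b hab).not_gt hb

/-- The facet functionals separate the vectors parallel to a polytope: a polytope, being bounded,
contains no line. -/
theorem IsPolytope.eq_zero_of_facets {P : Set V} (hP : IsPolytope P) {z : V}
    (hz : z ∈ vectorSpan ℝ P) (h : ∀ a b, IsFacetHyperplane P a b → a z = 0) : z = 0 := by
  rcases P.eq_empty_or_nonempty with rfl | ⟨p, hp⟩
  · simpa using hz
  by_contra hz0
  have hmem : ∀ t : ℝ, p + t • z ∈ P := fun t =>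
    hP.mem_of_facets hp (by simpa using Submodule.smul_mem _ t hz) fun a b hab => by
      simpa [h a b hab] using hab.2.1 p hp
  obtain ⟨C, hC⟩ := hP.isCompact.isBounded.exists_norm_le
  have hz' : 0 < ‖z‖ := norm_pos_iff.2 hz0
  have h1 := hC _ (hmem ((C + ‖p‖ + 1) / ‖z‖))
  have h2 := hC _ hp
  have h3 : ‖((C + ‖p‖ + 1) / ‖z‖) • z‖ = C + ‖p‖ + 1 := by
    rw [norm_smul, Real.norm_of_nonneg, div_mul_cancel₀ _ hz'.ne']
    have := norm_nonneg p
    exact div_nonneg (by linarith) hz'.le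
  have h4 := norm_sub_norm_le (((C + ‖p‖ + 1) / ‖z‖) • z) (-p)
  rw [sub_neg_eq_add, norm_neg, add_comm _ p] at h4
  linarith

end Normed

/-! ### Splittings of a polytope and their factors -/

section Splitting

variable {V : Type*} [AddCommGroup V] [Module ℝ V]

/-- A splitting of `P`: a linear map `π` that acts as a projection on the differences of points of
`P`, and such that the two components `π` and `1 - π` of points of `P` can be combined freely. It
presents `P` as the product of its images under `π` and `1 - π`, up to translation. -/
structure IsSplitting (π : V →ₗ[ℝ] V) (P : Set V) : Prop where
  mem : ∀ x ∈ P, ∀ y ∈ P, y + π (x - y) ∈ P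
  idem : ∀ x ∈ P, ∀ y ∈ P, π (π (x - y)) = π (x - y)

variable {π : V →ₗ[ℝ] V} {P : Set V}

theorem IsSplitting.compl (h : IsSplitting π P) : IsSplitting (LinearMap.id - π) P where
  mem x hx y hy := by
    have h1 := h.mem y hy x hx
    rw [← neg_sub, map_neg] at h1
    convert h1 using 1
    simp only [LinearMap.sub_apply, LinearMap.id_apply]
    abel
  idem x hx y hy := by
    have h1 := h.idem x hx y hy
    simp only [LinearMap.sub_apply, LinearMap.id_apply]
    rw [map_sub π (x - y) (π (x - y)), h1]
    abel

/-- The copy, through the point `w`, of the factor of `P` onto which `π` projects; the point `p` of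
`P` is sent to `w`. -/
def factor (π : V →ₗ[ℝ] V) (P : Set V) (p w : V) : Set V :=
  (fun x => w + π (x - p)) '' P

/-- The affine map that defines `Polytope.factor`. -/
noncomputable def factorMap (π : V →ₗ[ℝ] V) (p w : V) : V →ᵃ[ℝ] V :=
  AffineMap.const ℝ V (w - π p) + π.toAffineMap

theorem factorMap_apply (π : V →ₗ[ℝ] V) (p w x : V) : factorMap π p w x = w + π (x - p) := by
  simp [factorMap]
  abel

theorem factor_eq (π : V →ₗ[ℝ] V) (P : Set V) (p w : V) :
    factor π P p w = factorMap π p w '' P :=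
  Set.image_congr fun x _ => (factorMap_apply π p w x).symm

theorem vectorSpan_factor (π : V →ₗ[ℝ] V) (P : Set V) (p w : V) :
    vectorSpan ℝ (factor π P p w) = (vectorSpan ℝ P).map π := by
  rw [factor_eq, ← AffineMap.map_vectorSpan]
  simp [factorMap]

theorem IsPolytope.factor (hP : IsPolytope P) (π : V →ₗ[ℝ] V) (p w : V) :
    IsPolytope (factor π P p w) := by
  rw [factor_eq]
  exact hP.image _

/-- The facets of a factor come from facets of the whole polytope. -/
theorem IsSplitting.isFacetHyperplane [FiniteDimensional ℝ V] (h : IsSplitting π P) {p w : V}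
    {a : V →ₗ[ℝ] ℝ} {b : ℝ}
    (hab : IsFacetHyperplane (factor π P p w) a b) :
    IsFacetHyperplane P (a ∘ₗ π) (b - a (w - π p)) := by
  rw [isFacetHyperplane_iff] at hab ⊢
  obtain ⟨hle, hne, ⟨z, hz, haz⟩, hker⟩ := hab
  have hval : ∀ x, a (w + π (x - p)) = (a ∘ₗ π) x + a (w - π p) := by
    intro x
    simp only [map_add, map_sub, LinearMap.comp_apply]
    ring
  have himg : factor π P p w ∩ {x | a x = b} =
      factor π (P ∩ {x | (a ∘ₗ π) x = b - a (w - π p)}) p w := by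
    ext y
    constructor
    · rintro ⟨⟨x, hx, rfl⟩, hy⟩
      refine ⟨x, ⟨hx, ?_⟩, rfl⟩
      have := hval x
      rw [Set.mem_ofPred_eq] at hy ⊢
      linarith
    · rintro ⟨x, ⟨hx, hxb⟩, rfl⟩
      refine ⟨⟨x, hx, rfl⟩, ?_⟩
      have := hval x
      rw [Set.mem_ofPred_eq] at hxb ⊢
      linarith
  rw [himg] at hne hker
  simp only [vectorSpan_factor] at hz hker
  obtain ⟨z, hz, rfl⟩ := hz
  obtain ⟨q, hq, hqb⟩ : (P ∩ {x | (a ∘ₗ π) x = b - a (w - π p)}).Nonempty := by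
    simpa [factor] using hne
  refine ⟨fun x hx => ?_, ⟨q, hq, hqb⟩, ⟨z, hz, haz⟩, ?_⟩
  · have := hle _ ⟨x, hx, rfl⟩
    have := hval x
    simp only at *
    linarith
  -- The face contains a full copy of the complementary factor.
  have hcompl : ∀ z ∈ vectorSpan ℝ P, z - π z ∈
      vectorSpan ℝ (P ∩ {x | (a ∘ₗ π) x = b - a (w - π p)}) := by
    have hP : ∀ x ∈ P, x - q - π (x - q) ∈
        vectorSpan ℝ (P ∩ {x | (a ∘ₗ π) x = b - a (w - π p)}) := by
      intro x hx
      have h1 := vsub_mem_vectorSpan ℝ (s := P ∩ {x | (a ∘ₗ π) x = b - a (w - π p)})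
        (p₁ := q + (LinearMap.id - π : V →ₗ[ℝ] V) (x - q)) (p₂ := q)
        ⟨h.compl.mem x hx q hq, ?_⟩ ⟨hq, hqb⟩
      · simpa using h1
      · rw [Set.mem_ofPred_eq, ← hqb]
        simp only [LinearMap.comp_apply, map_add, LinearMap.sub_apply, LinearMap.id_apply,
          map_sub π (x - q) (π (x - q)), h.idem x hx q hq, sub_self, map_zero, add_zero]
    have : vectorSpan ℝ P ≤ (vectorSpan ℝ (P ∩ {x | (a ∘ₗ π) x = b - a (w - π p)})).comap
        (LinearMap.id - π) := by
      rw [vectorSpan_def, Submodule.span_le]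
      rintro _ ⟨x, hx, y, hy, rfl⟩
      have := Submodule.sub_mem _ (hP x hx) (hP y hy)
      simp only [SetLike.mem_coe, Submodule.mem_comap, LinearMap.sub_apply, LinearMap.id_apply,
        vsub_eq_sub]
      convert this using 1
      simp only [map_sub]
      abel
    exact fun z hz => by simpa using this hz
  rintro z ⟨hz, haz⟩
  obtain ⟨m, hm, hmz⟩ := hker ⟨⟨z, hz, rfl⟩, haz⟩
  have h1 := hcompl (z - m) (Submodule.sub_mem _ hz (vectorSpan_mono ℝ Set.inter_subset_left hm))
  rw [map_sub π z m, hmz, sub_self, sub_zero] at h1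
  simpa using Submodule.add_mem _ h1 hm

/-- Translates of vertices of a factor are vertices, if the translate passes through a vertex. -/
theorem IsSplitting.mem_extremePoints (h : IsSplitting π P) {p w v : V}
    (hp : p ∈ P.extremePoints ℝ) (hv : v ∈ (factor π P p w).extremePoints ℝ) :
    p - w + v ∈ P.extremePoints ℝ := by
  have hpP := hp.1
  obtain ⟨u, hu, rfl⟩ := hv.1
  have e : p - w + (w + π (u - p)) = p + π (u - p) := by abel
  simp only [e]
  -- The components of `x` under `π` and `1 - π` are determined by the extremality of the vertex of
  -- the factor and of `p`.
  have key : ∀ x ∈ P, ∀ y ∈ P, p + π (u - p) ∈ openSegment ℝ x y → x = p + π (u - p) := by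
    rintro x hx y hy ⟨s, t, hs, ht, hst, hxy⟩
    have hpi : s • π (x - p) + t • π (y - p) = π (u - p) := by
      have h1 := congrArg (fun z => π (z - p)) hxy
      simp only [add_sub_cancel_left] at h1
      rw [h.idem u hu p hpP] at h1
      rw [← h1, ← map_smul, ← map_smul, ← map_add]
      congr 1
      rw [smul_sub, smul_sub]
      nth_rewrite 3 [show p = (s + t) • p by rw [hst, one_smul]]
      rw [add_smul]
      abel
    have h1 : w + π (x - p) = w + π (u - p) :=
      hv.2 ⟨x, hx, rfl⟩ ⟨y, hy, rfl⟩ ⟨s, t, hs, ht, hst, by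
        simp only [smul_add]
        rw [add_add_add_comm, ← add_smul, hst, one_smul, hpi]⟩
    have h2 : p + (LinearMap.id - π : V →ₗ[ℝ] V) (x - p) = p :=
      hp.2 (h.compl.mem x hx p hpP) (h.compl.mem y hy p hpP) ⟨s, t, hs, ht, hst, by
        simp only [LinearMap.sub_apply, LinearMap.id_apply]
        have e1 : s • (p + (x - p - π (x - p))) + t • (p + (y - p - π (y - p))) =
            (s • x + t • y) - (s • π (x - p) + t • π (y - p)) := by
          simp only [smul_add, smul_sub]
          abel
        rw [e1, hpi, hxy]
        abel⟩
    simp only [LinearMap.sub_apply, LinearMap.id_apply] at h2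
    have h3 := add_left_cancel h1
    rw [h3] at h2
    have : x = p + (x - p - π (u - p)) + π (u - p) := by abel
    rw [this, h2]
  exact ⟨h.mem u hu p hpP, fun x hx y hy hxy => key x hx y hy hxy⟩

theorem IsSplitting.isInternalProductOf (h : IsSplitting π P) {Φ : Set V → Prop} {p : V}
    (hp : p ∈ P) (h0 : ∃ x ∈ P, π (x - p) ≠ 0) (h1 : ∃ x ∈ P, π (x - p) ≠ x - p)
    (hΦ : Φ (factor π P p p)) (hΦ' : Φ (factor (LinearMap.id - π) P p 0)) :
    IsInternalProductOf Φ P := by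
  refine ⟨2, le_rfl, ![factor π P p p, factor (LinearMap.id - π) P p 0], ?_, ?_⟩
  · refine Fin.forall_fin_two.2 ⟨⟨?_, hΦ⟩, ⟨?_, hΦ'⟩⟩
    · obtain ⟨x, hx, hne⟩ := h0
      exact ⟨_, ⟨x, hx, rfl⟩, _, ⟨p, hp, rfl⟩, by simpa [-map_sub] using hne⟩
    · obtain ⟨x, hx, hne⟩ := h1
      exact ⟨_, ⟨x, hx, rfl⟩, _, ⟨p, hp, rfl⟩, by
        simpa [-map_sub, sub_eq_zero] using hne.symm⟩
  refine ⟨?_, ?_, ?_⟩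
  · intro x hx
    obtain ⟨u, hu, hux⟩ := hx 0 trivial
    obtain ⟨v, hv, hvx⟩ := hx 1 trivial
    simp only [Fin.sum_univ_two]
    rw [← hux, ← hvx]
    convert h.mem u hu v hv using 1
    simp only [LinearMap.sub_apply, LinearMap.id_apply, map_sub]
    abel
  · -- Both components of a point are recovered from the point by means of `π`.
    have hrec : ∀ x ∈ Set.univ.pi ![factor π P p p, factor (LinearMap.id - π) P p 0],
        x 0 = p + π (x 0 + x 1 - p) := by
      intro x hx
      obtain ⟨u, hu, hux⟩ := hx 0 trivial
      obtain ⟨v, hv, hvx⟩ := hx 1 trivial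
      have e1 := h.idem u hu p hp
      have e2 := h.idem v hv p hp
      rw [← hux, ← hvx]
      have e3 : p + π (u - p) + (0 + (LinearMap.id - π : V →ₗ[ℝ] V) (v - p)) - p =
          π (u - p) + (v - p - π (v - p)) := by
        simp only [LinearMap.sub_apply, LinearMap.id_apply]
        abel
      simp only [e3]
      rw [map_add π (π (u - p)), e1, map_sub π (v - p) (π (v - p)), e2, sub_self, add_zero]
    intro x hx y hy hxy
    simp only [Fin.sum_univ_two] at hxy
    have e0 : x 0 = y 0 := by rw [hrec x hx, hrec y hy, hxy]
    have e1 : x 1 = y 1 := by rw [e0] at hxy; exact add_left_cancel hxy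
    funext i
    fin_cases i
    · exact e0
    · exact e1
  · intro x hx
    refine ⟨![p + π (x - p), 0 + (LinearMap.id - π : V →ₗ[ℝ] V) (x - p)], ?_, ?_⟩
    · intro i _
      fin_cases i
      · exact ⟨x, hx, rfl⟩
      · exact ⟨x, hx, rfl⟩
    · simp [Fin.sum_univ_two]

end Splitting

/-! ### Factors of 2-level and of compressed polytopes -/

section TwoLevel

variable {V : Type*} [NormedAddCommGroup V] [NormedSpace ℝ V] [FiniteDimensional ℝ V]
  {π : V →ₗ[ℝ] V} {P : Set V}

theorem IsTwoLevel.factor (hP : IsTwoLevel P) (h : IsSplitting π P) (p w : V) :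
    IsTwoLevel (factor π P p w) := by
  refine ⟨hP.1.factor π p w, fun a b hab => ?_⟩
  obtain ⟨c, hc⟩ := hP.2 _ _ (h.isFacetHyperplane hab)
  refine ⟨c + a (w - π p), fun v hv => ?_⟩
  have hcont : Continuous (factorMap π p w) := (factorMap π p w).continuous_of_finiteDimensional
  rw [factor_eq] at hv
  obtain ⟨u, hu, rfl⟩ := surjOn_extremePoints_image
    (⟨factorMap π p w, hcont⟩ : V →ᴬ[ℝ] V) hP.1.isCompact hv
  have hval : a (factorMap π p w u) = (a ∘ₗ π) u + a (w - π p) := by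
    rw [factorMap_apply]
    simp only [map_add, map_sub, LinearMap.comp_apply]
    ring
  change a (factorMap π p w u) = b ∨ a (factorMap π p w u) = _
  rw [hval]
  rcases hc u hu with hb | hb
  · left; linarith
  · right; linarith

end TwoLevel

section Compressed

variable {n : ℕ}

theorem IsLatticePoint.add {x y : Fin n → ℝ} (hx : IsLatticePoint x) (hy : IsLatticePoint y) :
    IsLatticePoint (x + y) := fun i => by
  obtain ⟨a, ha⟩ := hx i
  obtain ⟨b, hb⟩ := hy i
  exact ⟨a + b, by simp [ha, hb]⟩

theorem IsLatticePoint.sub {x y : Fin n → ℝ} (hx : IsLatticePoint x) (hy : IsLatticePoint y) :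
    IsLatticePoint (x - y) := fun i => by
  obtain ⟨a, ha⟩ := hx i
  obtain ⟨b, hb⟩ := hy i
  exact ⟨a - b, by simp [ha, hb]⟩

theorem isLatticePoint_zero : IsLatticePoint (0 : Fin n → ℝ) := fun _ => ⟨0, by simp⟩

variable {P : Set (Fin n → ℝ)}

theorem IsCompressed.isTwoLevel (hP : IsCompressed P) : IsTwoLevel P := by
  refine ⟨hP.1.1, fun a b hab => ?_⟩
  by_cases h : ∃ v ∈ P.extremePoints ℝ, a v ≠ b
  · obtain ⟨v, hv, hvb⟩ := h
    refine ⟨a v, fun u hu => or_iff_not_imp_left.2 fun hub => ?_⟩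
    exact hP.2 a b hab ⟨hub, u, hu.1, hP.1.2 u hu, rfl⟩ ⟨hvb, v, hv.1, hP.1.2 v hv, rfl⟩
  · push Not at h
    exact ⟨b, fun v hv => Or.inl (h v hv)⟩

theorem IsCompressed.factor {π : (Fin n → ℝ) →ₗ[ℝ] (Fin n → ℝ)} (hP : IsCompressed P)
    (h : IsSplitting π P) {p w : Fin n → ℝ} (hp : p ∈ P.extremePoints ℝ)
    (hw : IsLatticePoint w) : IsCompressed (factor π P p w) := by
  have hpl := hP.1.2 p hp
  refine ⟨⟨hP.1.1.factor π p w, fun v hv => ?_⟩, fun a b hab => ?_⟩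
  · have h1 := ((hP.1.2 _ (h.mem_extremePoints hp hv)).sub hpl).add hw
    convert h1 using 1
    abel
  · have key : ∀ c ∈ {c : ℝ | c ≠ b ∧ ∃ x ∈ Polytope.factor π P p w, IsLatticePoint x ∧ a x = c},
        c - a (w - π p) ∈ {c : ℝ | c ≠ b - a (w - π p) ∧
          ∃ x ∈ P, IsLatticePoint x ∧ (a ∘ₗ π) x = c} := by
      rintro _ ⟨hcb, _, ⟨u, hu, rfl⟩, hl, rfl⟩
      refine ⟨fun he => hcb (by linarith), p + π (u - p), h.mem u hu p hp.1, ?_, ?_⟩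
      · have e : p + π (u - p) = w + π (u - p) - w + p := by abel
        rw [e]
        exact (hl.sub hw).add hpl
      · simp only [LinearMap.comp_apply, map_add π p, h.idem u hu p hp.1]
        simp only [map_add, map_sub]
        ring
    intro c hc d hd
    have := hP.2 _ _ (h.isFacetHyperplane hab) (key c hc) (key d hd)
    linarith

end Compressed

/-! ### Simultaneous eigenvectors and projections -/

section Diagonal

variable {V : Type*} [AddCommGroup V] [Module ℝ V] [FiniteDimensional ℝ V]

/-- Suppose that a separating family `N` of functionals on `L` consists of eigenvectors, with
eigenvalues `μ`, of the transpose of an endomorphism of `L`. Then the projection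
of `L` onto the eigenspace of eigenvalue `μ₀` fixes the functionals with `μ a = μ₀` and kills the
other ones. -/
theorem exists_eigenprojection {L : Submodule ℝ V} {N : Set (V →ₗ[ℝ] ℝ)}
    (hsep : ∀ z ∈ L, (∀ a ∈ N, a z = 0) → z = 0) (μ : (V →ₗ[ℝ] ℝ) → ℝ)
    (hex : ∀ z ∈ L, ∃ w ∈ L, ∀ a ∈ N, a w = μ a * a z) (μ₀ : ℝ) :
    ∃ π : V →ₗ[ℝ] V, ∀ z ∈ L, π z ∈ L ∧
      (∀ a ∈ N, μ a = μ₀ → a (π z) = a z) ∧ (∀ a ∈ N, μ a ≠ μ₀ → a (π z) = 0) := by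
  have hext : ∀ z w : L, (∀ a ∈ N, a z = a w) → z = w := fun z w h => Subtype.ext <|
    sub_eq_zero.1 (hsep _ (L.sub_mem z.2 w.2) fun a ha => by rw [map_sub, h a ha, sub_self])
  have hex' : ∀ z : L, ∃ w : L, ∀ a ∈ N, a w = (μ a - μ₀) * a z := fun z => by
    obtain ⟨w, hw, h⟩ := hex z z.2
    exact ⟨⟨w, hw⟩ - μ₀ • z, fun a ha => by simp [h a ha, sub_mul]⟩
  choose f hf using hex'
  let S : L →ₗ[ℝ] L :=
    { toFun := f
      map_add' := fun z w => hext _ _ fun a ha => by simp [hf _ a ha, mul_add]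
      map_smul' := fun t z => hext _ _ fun a ha => by simp [hf _ a ha]; ring }
  -- `S` is `T - μ₀`, where `T` is the endomorphism with `a ∘ T = μ a • a`.
  have hS : ∀ z : L, ∀ a ∈ N, a (S z) = (μ a - μ₀) * a z := hf
  have hdisj : Disjoint (LinearMap.ker S) (LinearMap.range S) := by
    rw [Submodule.disjoint_def]
    rintro _ hker ⟨w, rfl⟩
    refine hext _ _ fun a ha => ?_
    have h1 : (μ a - μ₀) * ((μ a - μ₀) * a w) = 0 := by
      rw [← hS w a ha, ← hS _ a ha, LinearMap.mem_ker.1 hker]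
      simp
    rw [hS w a ha]
    rcases mul_eq_zero.1 h1 with h | h <;> simp [h]
  have hcompl : IsCompl (LinearMap.ker S) (LinearMap.range S) :=
    (Submodule.isCompl_iff_disjoint _ _ (by
      rw [add_comm, LinearMap.finrank_range_add_finrank_ker])).2 hdisj
  obtain ⟨π, hπ⟩ := LinearMap.exists_extend (L.subtype ∘ₗ
    (LinearMap.ker S).projection (LinearMap.range S) hcompl)
  refine ⟨π, fun z hz => ?_⟩
  obtain ⟨x, y, hxy, -⟩ := Submodule.existsUnique_add_of_isCompl hcompl (⟨z, hz⟩ : L)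
  have hzxy : z = ((x : L) : V) + ((y : L) : V) := congrArg Subtype.val hxy.symm
  have hπz : π z = ((x : L) : V) := by
    have := LinearMap.congr_fun hπ (⟨z, hz⟩ : L)
    rw [← hxy] at this
    simp only [LinearMap.comp_apply, Submodule.subtype_apply, map_add] at this
    rw [Submodule.projection_apply_left, Submodule.projection_apply_right] at this
    rw [hzxy, map_add, this]
    simp
  rw [hπz]
  refine ⟨(x : L).2, fun a ha hμ => ?_, fun a ha hμ => ?_⟩
  · obtain ⟨w, hw⟩ := y.2
    have := hS w a ha
    rw [hμ, sub_self, zero_mul, hw] at this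
    rw [hzxy, map_add, this, add_zero]
  · have := hS x a ha
    rw [LinearMap.mem_ker.1 x.2] at this
    simpa [sub_eq_zero, hμ] using this.symm

end Diagonal

/-! ### Minkowski summands of 2-level polytopes -/

section Summands

variable {V : Type*} [NormedAddCommGroup V] [NormedSpace ℝ V] {P Q R : Set V}

theorem sub_mem_vectorSpan_of_add_eq (hPQR : P = Q + R) (hR : R.Nonempty) {q q' : V} (hq : q ∈ Q)
    (hq' : q' ∈ Q) : q - q' ∈ vectorSpan ℝ P := by
  obtain ⟨r, hr⟩ := hR
  have := vsub_mem_vectorSpan ℝ (s := P) (p₁ := q + r) (p₂ := q' + r)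
    (hPQR ▸ Set.add_mem_add hq hr) (hPQR ▸ Set.add_mem_add hq' hr)
  simpa using this

/-- If `P = Q + R`, a functional bounded above on `P` by its value at `q + r` is bounded
above on `Q` by its value at `q`. -/
theorem apply_le_of_add_eq (hPQR : P = Q + R) {a : V →ₗ[ℝ] ℝ} {q r : V} (hr : r ∈ R)
    (hmax : ∀ x ∈ P, a x ≤ a (q + r)) {q' : V} (hq' : q' ∈ Q) : a q' ≤ a q := by
  have := hmax (q' + r) (hPQR ▸ Set.add_mem_add hq' hr)
  simpa using this

variable [FiniteDimensional ℝ V]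

/-- The second level of a facet-defining functional may be taken to be its minimum. -/
theorem IsTwoLevel.exists_level (hP : IsTwoLevel P) {a : V →ₗ[ℝ] ℝ} {b : ℝ}
    (hab : IsFacetHyperplane P a b) :
    ∃ c < b, (∀ x ∈ P, c ≤ a x) ∧ ∀ v ∈ P.extremePoints ℝ, a v = b ∨ a v = c := by
  obtain ⟨c, hc⟩ := hP.2 a b hab
  obtain ⟨hle, -, ⟨z, hz, haz⟩, -⟩ := isFacetHyperplane_iff.1 hab
  obtain ⟨v, hv, hvb⟩ : ∃ v ∈ P.extremePoints ℝ, a v ≠ b := by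
    by_contra! h
    refine haz (apply_eq_zero_of_mem_vectorSpan h ?_)
    rwa [← direction_affineSpan, ← affineSpan_convexHull, direction_affineSpan,
      hP.1.convexHull_extremePoints]
  have hvc : a v = c := (hc v hv).resolve_left hvb
  have hcb : c < b := hvc ▸ lt_of_le_of_ne (hle v hv.1) hvb
  refine ⟨c, hcb, fun x hx => ?_, hc⟩
  rw [← hP.1.convexHull_extremePoints] at hx
  refine convexHull_min (t := {y | c ≤ a y}) (fun u hu => ?_) (convex_halfSpace_ge a.isLinear c) hx
  rcases hc u hu with h | h
  · exact hcb.le.trans h.ge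
  · exact h.ge

/-- Each facet functional rescales the differences of the summands of the vertices by a
constant: a vertex lies in the facet or in the opposite face, and so do, for the summand `Q`, the
components of the vertices. -/
theorem IsTwoLevel.exists_scale (hP : IsTwoLevel P) (hPQR : P = Q + R) {q r : V → V}
    (hq : ∀ u ∈ P.extremePoints ℝ, q u ∈ Q) (hr : ∀ u ∈ P.extremePoints ℝ, r u ∈ R)
    (hqr : ∀ u ∈ P.extremePoints ℝ, q u + r u = u) {a : V →ₗ[ℝ] ℝ} {b : ℝ}
    (hab : IsFacetHyperplane P a b) :
    ∃ μ : ℝ, ∀ u ∈ P.extremePoints ℝ, ∀ v ∈ P.extremePoints ℝ,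
      a (q u - q v) = μ * a (u - v) := by
  obtain ⟨c, hcb, hge, hc⟩ := hP.exists_level hab
  have hle := hab.2.1
  have hb : ∀ u ∈ P.extremePoints ℝ, a u = b → ∀ v ∈ P.extremePoints ℝ, a (q v) ≤ a (q u) :=
    fun u hu hub v hv => apply_le_of_add_eq hPQR (hr u hu)
      (by rw [hqr u hu, hub]; exact hle) (hq v hv)
  have hc' : ∀ u ∈ P.extremePoints ℝ, a u = c → ∀ v ∈ P.extremePoints ℝ, a (q u) ≤ a (q v) :=
    fun u hu huc v hv => by
      have := apply_le_of_add_eq (a := -a) hPQR (hr u hu) (q := q u)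
        (by rw [hqr u hu]; intro x hx; simpa [huc] using hge x hx) (hq v hv)
      simpa using this
  have hbc : b - c ≠ 0 := (sub_pos.2 hcb).ne'
  by_cases hex : (∃ u ∈ P.extremePoints ℝ, a u = b) ∧ ∃ v ∈ P.extremePoints ℝ, a v = c
  · obtain ⟨⟨u₀, hu₀, hub⟩, v₀, hv₀, hvc⟩ := hex
    have hqb : ∀ u ∈ P.extremePoints ℝ, a u = b → a (q u) = a (q u₀) := fun u hu h =>
      (hb u₀ hu₀ hub u hu).antisymm (hb u hu h u₀ hu₀)
    have hqc : ∀ u ∈ P.extremePoints ℝ, a u = c → a (q u) = a (q v₀) := fun u hu h =>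
      (hc' u hu h v₀ hv₀).antisymm (hc' v₀ hv₀ hvc u hu)
    refine ⟨(a (q u₀) - a (q v₀)) / (b - c), fun u hu v hv => ?_⟩
    rw [map_sub, map_sub, div_mul_eq_mul_div, eq_div_iff hbc]
    rcases hc u hu with h | h <;> rcases hc v hv with h' | h'
    · rw [hqb u hu h, hqb v hv h', h, h']; ring
    · rw [hqb u hu h, hqc v hv h', h, h']
    · rw [hqc u hu h, hqb v hv h', h, h']; ring
    · rw [hqc u hu h, hqc v hv h', h, h']; ring
  -- Otherwise all vertices lie on one level, where `a` is constant on their components in `Q`.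
  · refine ⟨0, fun u hu v hv => ?_⟩
    rw [map_sub, zero_mul, sub_eq_zero]
    rcases hc u hu with h | h
    · rcases hc v hv with h' | h'
      · exact (hb v hv h' u hu).antisymm (hb u hu h v hv)
      · exact absurd ⟨⟨u, hu, h⟩, v, hv, h'⟩ hex
    · rcases hc v hv with h' | h'
      · exact absurd ⟨⟨v, hv, h'⟩, u, hu, h⟩ hex
      · exact (hc' u hu h v hv).antisymm (hc' v hv h' u hu)

/-- If all components in `Q` of the vertices are rescaled by one and the same positive factor, then
`Q` is homothetic to `P`: it satisfies the inequalities of the facets of the rescaled `P`. -/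
theorem IsPolytope.isHomothetic_of_scale (hP : IsPolytope P) (hne : P.Nonempty)
    (hQ : Convex ℝ Q) (hPQR : P = Q + R) {q r : V → V}
    (hq : ∀ u ∈ P.extremePoints ℝ, q u ∈ Q) (hr : ∀ u ∈ P.extremePoints ℝ, r u ∈ R)
    (hqr : ∀ u ∈ P.extremePoints ℝ, q u + r u = u) {μ : ℝ} (hμ : 0 < μ)
    (hscale : ∀ u ∈ P.extremePoints ℝ, ∀ v ∈ P.extremePoints ℝ, q u - q v = μ • (u - v)) :
    IsHomothetic P Q := by
  obtain ⟨p, hp⟩ := hP.isCompact.extremePoints_nonempty hne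
  have hqu : ∀ u ∈ P.extremePoints ℝ, q u = q p - μ • p + μ • u := fun u hu => by
    have := hscale u hu p hp
    rw [smul_sub, sub_eq_iff_eq_add] at this
    rw [this]
    abel
  refine ⟨μ, q p - μ • p, hμ, Set.Subset.antisymm (fun y hy => ?_) ?_⟩
  · have hy' : y - q p ∈ vectorSpan ℝ P :=
      sub_mem_vectorSpan_of_add_eq hPQR ⟨_, hr p hp⟩ hy (hq p hp)
    refine ⟨p + μ⁻¹ • (y - q p), hP.mem_of_facets hp.1
      (by simpa using Submodule.smul_mem _ μ⁻¹ hy') fun a b hab => ?_, ?_⟩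
    · obtain ⟨u, hu, hub⟩ : ∃ u ∈ P.extremePoints ℝ, a u = b := by
        by_contra! h
        obtain ⟨x, hx, hxb⟩ := hab.2.2.1
        rw [← hP.convexHull_extremePoints] at hx
        have := convexHull_min (t := {y | a y < b})
          (fun u hu => lt_of_le_of_ne (hab.2.1 u hu.1) (h u hu))
          (convex_halfSpace_lt a.isLinear b) hx
        exact this.ne hxb
      have h1 := apply_le_of_add_eq hPQR (hr u hu) (by rw [hqr u hu, hub]; exact hab.2.1) hy
      have h2 := congrArg a (hqu u hu)
      simp only [map_add, map_sub, map_smul, smul_eq_mul, hub] at h2 ⊢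
      have h3 : a y - a (q p) ≤ μ * (b - a p) := by linarith
      have h4 : μ⁻¹ * (a y - a (q p)) ≤ b - a p := by
        rwa [inv_mul_le_iff₀ hμ]
      linarith
    · simp only [smul_add, smul_inv_smul₀ hμ.ne']
      abel
  · rintro _ ⟨x, hx, rfl⟩
    let f : V →ᵃ[ℝ] V := AffineMap.const ℝ V (q p - μ • p) + (μ • LinearMap.id).toAffineMap
    have hf : ∀ x, f x = q p - μ • p + μ • x := fun x => by simp [f]
    have hsub : convexHull ℝ (P.extremePoints ℝ) ⊆ f ⁻¹' Q :=
      convexHull_min (fun u hu => by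
        rw [Set.mem_preimage, hf, ← hqu u hu]
        exact hq u hu) (hQ.affine_preimage f)
    rw [hP.convexHull_extremePoints] at hsub
    have := hsub hx
    rwa [Set.mem_preimage, hf] at this

/-- A decomposable 2-level polytope has a nontrivial splitting. -/
theorem IsTwoLevel.exists_splitting (hP : IsTwoLevel P) (hd : IsDecomposable P) :
    ∃ π : V →ₗ[ℝ] V, IsSplitting π P ∧ (∃ z ∈ vectorSpan ℝ P, π z ≠ 0) ∧
      ∃ z ∈ vectorSpan ℝ P, π z ≠ z := by
  obtain ⟨Q, R, hQ, hR, hPQR, hPQ, hPR⟩ := hd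
  have hne : P.Nonempty := by
    by_contra! h
    have hh : ∀ S : Set V, S = ∅ → IsHomothetic P S := fun S hS => ⟨1, 0, one_pos, by simp [hS, h]⟩
    rw [h, eq_comm, Set.add_eq_empty] at hPQR
    exact hPQR.elim (fun h' => hPQ (hh _ h')) fun h' => hPR (hh _ h')
  have hsum : ∀ u, ∃ x y, u ∈ P.extremePoints ℝ → x ∈ Q ∧ y ∈ R ∧ x + y = u := fun u => by
    by_cases hu : u ∈ P.extremePoints ℝ
    · have := hu.1
      rw [hPQR] at this
      obtain ⟨x, hx, y, hy, h⟩ := this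
      exact ⟨x, y, fun _ => ⟨hx, hy, h⟩⟩
    · exact ⟨0, 0, fun h => absurd h hu⟩
  choose q r hqr' using hsum
  have hq : ∀ u ∈ P.extremePoints ℝ, q u ∈ Q := fun u hu => (hqr' u hu).1
  have hr : ∀ u ∈ P.extremePoints ℝ, r u ∈ R := fun u hu => (hqr' u hu).2.1
  have hqr : ∀ u ∈ P.extremePoints ℝ, q u + r u = u := fun u hu => (hqr' u hu).2.2
  have hRne : R.Nonempty := by
    rw [hPQR] at hne
    exact hne.of_image2_right
  have hqL : ∀ u ∈ P.extremePoints ℝ, ∀ v ∈ P.extremePoints ℝ, q u - q v ∈ vectorSpan ℝ P :=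
    fun u hu v hv => sub_mem_vectorSpan_of_add_eq hPQR hRne (hq u hu) (hq v hv)
  set N : Set (V →ₗ[ℝ] ℝ) := {a | ∃ b, IsFacetHyperplane P a b} with hN
  have hsep : ∀ z ∈ vectorSpan ℝ P, (∀ a ∈ N, a z = 0) → z = 0 := fun z hz h =>
    hP.1.eq_zero_of_facets hz fun a b hab => h a ⟨b, hab⟩
  have hμ' : ∀ a, ∃ μ : ℝ, a ∈ N → ∀ u ∈ P.extremePoints ℝ, ∀ v ∈ P.extremePoints ℝ,
      a (q u - q v) = μ * a (u - v) := fun a => by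
    by_cases ha : a ∈ N
    · obtain ⟨b, hab⟩ := ha
      obtain ⟨μ, h⟩ := hP.exists_scale hPQR hq hr hqr hab
      exact ⟨μ, fun _ => h⟩
    · exact ⟨0, fun h => absurd h ha⟩
  choose μ hμ using hμ'
  -- A single scale would make one of the summands homothetic to `P`.
  have hvar : ∀ μ₀ : ℝ, ∃ a ∈ N, μ a ≠ μ₀ := by
    by_contra! h
    obtain ⟨μ₀, h⟩ := h
    have hscale : ∀ u ∈ P.extremePoints ℝ, ∀ v ∈ P.extremePoints ℝ,
        q u - q v = μ₀ • (u - v) := fun u hu v hv =>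
      sub_eq_zero.1 <| hsep _ (Submodule.sub_mem _ (hqL u hu v hv)
        (Submodule.smul_mem _ _ (vsub_mem_vectorSpan ℝ hu.1 hv.1))) fun a ha => by
          rw [map_sub, map_smul, hμ a ha u hu v hv, h a ha, smul_eq_mul, sub_self]
    rcases lt_or_ge 0 μ₀ with h0 | h0
    · exact hPQ (hP.1.isHomothetic_of_scale hne hQ.convex hPQR hq hr hqr h0 hscale)
    -- The scales for `R` are complementary to those for `Q`.
    · refine hPR (hP.1.isHomothetic_of_scale (μ := 1 - μ₀) hne hR.convex
        (hPQR.trans (add_comm Q R)) hr hq (fun u hu => (add_comm _ _).trans (hqr u hu))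
        (by linarith) fun u hu v hv => ?_)
      have e : r u - r v = (u - v) - (q u - q v) := by
        nth_rewrite 2 [← hqr u hu]
        nth_rewrite 2 [← hqr v hv]
        abel
      rw [e, hscale u hu v hv, sub_smul, one_smul]
  have hex : ∀ z ∈ vectorSpan ℝ P, ∃ w ∈ vectorSpan ℝ P, ∀ a ∈ N, a w = μ a * a z := by
    intro z hz
    have hspan : vectorSpan ℝ P = Submodule.span ℝ (P.extremePoints ℝ -ᵥ P.extremePoints ℝ) := by
      rw [← vectorSpan_def]
      conv_lhs => rw [← hP.1.convexHull_extremePoints, ← direction_affineSpan,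
        affineSpan_convexHull, direction_affineSpan]
    have hz' := hspan ▸ hz
    induction hz' using Submodule.span_induction with
    | mem x hx =>
      obtain ⟨u, hu, v, hv, rfl⟩ := hx
      exact ⟨q u - q v, hqL u hu v hv, fun a ha => hμ a ha u hu v hv⟩
    | zero => exact ⟨0, Submodule.zero_mem _, by simp⟩
    | add x y hx hy ihx ihy =>
      obtain ⟨w, hw, h⟩ := ihx (hspan ▸ hx)
      obtain ⟨w', hw', h'⟩ := ihy (hspan ▸ hy)
      exact ⟨w + w', Submodule.add_mem _ hw hw', fun a ha => by
        rw [map_add, map_add, h a ha, h' a ha, mul_add]⟩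
    | smul t x hx ih =>
      obtain ⟨w, hw, h⟩ := ih (hspan ▸ hx)
      exact ⟨t • w, Submodule.smul_mem _ t hw, fun a ha => by
        rw [map_smul, map_smul, h a ha, smul_eq_mul, smul_eq_mul]; ring⟩
  -- Any facet functional `a₀` will do; `hvar 0` merely provides one.
  obtain ⟨a₀, ha₀, -⟩ := hvar 0
  obtain ⟨a₁, ha₁, hne₁⟩ := hvar (μ a₀)
  obtain ⟨π, hπ⟩ := exists_eigenprojection hsep μ hex (μ a₀)
  refine ⟨π, ⟨fun x hx y hy => ?_, fun x hx y hy => ?_⟩, ?_, ?_⟩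
  · have hxy : x - y ∈ vectorSpan ℝ P := vsub_mem_vectorSpan ℝ hx hy
    refine hP.1.mem_of_facets hy (by simpa using (hπ _ hxy).1) fun a b hab => ?_
    by_cases h : μ a = μ a₀
    · rw [map_add, (hπ _ hxy).2.1 a ⟨b, hab⟩ h, map_sub, add_sub_cancel]
      exact hab.2.1 x hx
    · rw [map_add, (hπ _ hxy).2.2 a ⟨b, hab⟩ h, add_zero]
      exact hab.2.1 y hy
  · have hxy : x - y ∈ vectorSpan ℝ P := vsub_mem_vectorSpan ℝ hx hy
    have h1 := hπ _ hxy
    have h2 := hπ _ h1.1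
    refine sub_eq_zero.1 (hsep _ (Submodule.sub_mem _ h2.1 h1.1) fun a ha => ?_)
    by_cases h : μ a = μ a₀
    · rw [map_sub, h2.2.1 a ha h, sub_self]
    · rw [map_sub, h2.2.2 a ha h, h1.2.2 a ha h, sub_self]
  · obtain ⟨b, hab⟩ := id ha₀
    obtain ⟨z, hz, haz⟩ := (isFacetHyperplane_iff.1 hab).2.2.1
    refine ⟨z, hz, fun h => haz ?_⟩
    rw [← (hπ z hz).2.1 a₀ ha₀ rfl, h, map_zero]
  · obtain ⟨b, hab⟩ := id ha₁
    obtain ⟨z, hz, haz⟩ := (isFacetHyperplane_iff.1 hab).2.2.1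
    refine ⟨z, hz, fun h => haz ?_⟩
    rw [← (hπ z hz).2.2 a₁ ha₁ hne₁, h]

/-- A decomposable 2-level polytope is an internal product; the splitting can be based at
any vertex `p`. -/
theorem IsTwoLevel.isInternalProductOf (hP : IsTwoLevel P) (hd : IsDecomposable P)
    {Φ : Set V → Prop}
    (hΦ : ∀ π : V →ₗ[ℝ] V, IsSplitting π P → ∀ p ∈ P.extremePoints ℝ,
      Φ (Polytope.factor π P p p) ∧ Φ (Polytope.factor π P p 0)) :
    IsInternalProductOf Φ P := by
  obtain ⟨π, hπ, ⟨z, hz, hz0⟩, z', hz', hz1⟩ := hP.exists_splitting hd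
  have hne : P.Nonempty := by
    by_contra! h
    rw [h] at hz
    simp only [vectorSpan_empty, Submodule.mem_bot] at hz
    exact hz0 (by rw [hz, map_zero])
  obtain ⟨p, hp⟩ := hP.1.isCompact.extremePoints_nonempty hne
  have key : ∀ f : V →ₗ[ℝ] V, (∃ z ∈ vectorSpan ℝ P, f z ≠ 0) → ∃ x ∈ P, f (x - p) ≠ 0 := by
    rintro f ⟨z, hz, hfz⟩
    by_contra! h
    rw [vectorSpan_eq_span_vsub_set_right ℝ hp.1] at hz
    refine hfz (LinearMap.mem_ker.1 ((Submodule.span_le.2 ?_ : _ ≤ LinearMap.ker f) hz))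
    rintro _ ⟨x, hx, rfl⟩
    exact h x hx
  refine hπ.isInternalProductOf hp.1 (key π ⟨z, hz, hz0⟩) ?_ (hΦ π hπ p hp).1
    (hΦ _ hπ.compl p hp).2
  obtain ⟨x, hx, h⟩ := key (LinearMap.id - π) ⟨z', hz', by
    simpa [sub_eq_zero] using hz1.symm⟩
  refine ⟨x, hx, fun h' => h ?_⟩
  rw [LinearMap.sub_apply, LinearMap.id_apply, h', sub_self]

end Summands

/-! ### Products are decomposable -/

section Products

variable {V : Type*} [AddCommGroup V] [Module ℝ V]

/-- A summand `A` of a direct sum `A + B` of convex sets is not homothetic to the sum: otherwise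
`A` would contain a segment parallel to a given segment of `B`. -/
theorem not_isHomothetic_add {A B : Set V} (hA : Convex ℝ A) (hB : Convex ℝ B)
    (hAne : A.Nonempty) (hBnt : B.Nontrivial)
    (hinj : ∀ a ∈ A, ∀ a' ∈ A, ∀ b ∈ B, ∀ b' ∈ B, a + b = a' + b' → b = b') :
    ¬ IsHomothetic (A + B) A := by
  rintro ⟨t, v, ht, hAv⟩
  obtain ⟨a, ha⟩ := hAne
  obtain ⟨b, hb, b', hb', hne⟩ := hBnt
  have hmem : ∀ y ∈ B, v + t • (a + y) ∈ A := fun y hy => by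
    rw [hAv]
    exact ⟨a + y, Set.add_mem_add ha hy, rfl⟩
  -- With these weights, moving from `b` towards `b'` in `B` and from `v + t • (a + b)` towards
  -- `v + t • (a + b')` in `A` gives the same displacement `(t * s) • (b' - b)`.
  have hs : 0 < 1 / (1 + t) := by positivity
  have hst : (1 / (1 + t)) + t * (1 / (1 + t)) = 1 := by field_simp
  set s := 1 / (1 + t) with hs_def
  have hts : 0 < t * s := mul_pos ht hs
  have h1 := hA (hmem b hb) (hmem b' hb') hts.le hs.le (by linarith)
  have h2 := hB hb hb' hs.le hts.le hst
  have h3 := hinj _ h1 _ (hmem b hb) _ hb _ h2 (by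
    have : ∀ x y : V, (t * s) • (v + t • (a + x)) + s • (v + t • (a + y)) + x =
        ((s + t * s) • (v + t • (a + x))) + ((s + t * s) • x) + (t * s) • (y - x) +
          (1 - (s + t * s)) • x := by
      intro x y
      module
    rw [this, hst]
    have h4 : b = (s + t * s) • b := by rw [hst, one_smul]
    nth_rewrite 2 [h4]
    module)
  have h5 : (t * s) • (b' - b) = 0 := by
    have : (t * s) • (b' - b) = s • b + (t * s) • b' - (s + t * s) • b := by module
    rw [this, hst, one_smul, ← h3, sub_self]
  rcases smul_eq_zero.1 h5 with h | h
  · exact hts.ne' h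
  · exact hne (sub_eq_zero.1 h).symm

theorem isDecomposable_add {A B : Set V} (hA : IsPolytope A) (hB : IsPolytope B)
    (hAnt : A.Nontrivial) (hBnt : B.Nontrivial)
    (hinj : ∀ a ∈ A, ∀ a' ∈ A, ∀ b ∈ B, ∀ b' ∈ B, a + b = a' + b' → a = a' ∧ b = b') :
    IsDecomposable (A + B) := by
  refine ⟨A, B, hA, hB, rfl, ?_, ?_⟩
  · exact not_isHomothetic_add hA.convex hB.convex hAnt.nonempty hBnt
      fun a ha a' ha' b hb b' hb' h => (hinj a ha a' ha' b hb b' hb' h).2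
  · rw [add_comm A B]
    exact not_isHomothetic_add hB.convex hA.convex hBnt.nonempty hAnt
      fun b hb b' hb' a ha a' ha' h =>
        (hinj a ha a' ha' b hb b' hb' (by rw [add_comm a, add_comm a', h])).1

/-- A product of at least two proper polytopes is the direct sum of its first factor and of the
product of the other ones. -/
theorem isDecomposable_of_bijOn_pi {k : ℕ} (hk : 2 ≤ k) {E : Fin k → Type*}
    [∀ i, AddCommGroup (E i)] [∀ i, Module ℝ (E i)] {Q : ∀ i, Set (E i)}
    (hnt : ∀ i, (Q i).Nontrivial) (hpoly : ∀ i, IsPolytope (Q i)) {P : Set V}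
    (g : (∀ i, E i) →ᵃ[ℝ] V) (hg : Set.BijOn g (Set.univ.pi Q) P) : IsDecomposable P := by
  classical
  let i₀ : Fin k := ⟨0, by omega⟩
  let i₁ : Fin k := ⟨1, by omega⟩
  have hi : i₁ ≠ i₀ := by simp [i₀, i₁, Fin.ext_iff]
  choose q hq using fun i => (hnt i).nonempty
  have hC : IsPolytope (Set.univ.pi Q) := IsPolytope.pi hpoly
  -- `e x` replaces all coordinates of `x` but the first one by those of `q`; `e' x` replaces the
  -- first coordinate.
  let ρ : (∀ i, E i) →ₗ[ℝ] (∀ i, E i) := LinearMap.single ℝ E i₀ ∘ₗ LinearMap.proj i₀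
  let e : (∀ i, E i) →ᵃ[ℝ] (∀ i, E i) := AffineMap.const ℝ (∀ i, E i) (q - ρ q) + ρ.toAffineMap
  let e' : (∀ i, E i) →ᵃ[ℝ] (∀ i, E i) :=
    AffineMap.const ℝ (∀ i, E i) (ρ q) + (LinearMap.id - ρ).toAffineMap
  have he0 : ∀ x, e x i₀ = x i₀ := fun x => by simp [e, ρ]
  have hej : ∀ x, ∀ j ≠ i₀, e x j = q j := fun x j hj => by simp [e, ρ, hj]
  have he'0 : ∀ x, e' x i₀ = q i₀ := fun x => by simp [e', ρ]
  have he'j : ∀ x, ∀ j ≠ i₀, e' x j = x j := fun x j hj => by simp [e', ρ, hj]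
  let A : Set V := (g.comp e) '' Set.univ.pi Q
  let B : Set V := (g.comp e' - AffineMap.const ℝ (∀ i, E i) (g q)) '' Set.univ.pi Q
  -- the point with first coordinate that of `x` and other coordinates those of `y`
  let m : (∀ i, E i) → (∀ i, E i) → (∀ i, E i) := fun x y => e x + e' y - q
  have hm0 : ∀ x y, m x y i₀ = x i₀ := fun x y => by simp [m, he0, he'0]
  have hmj : ∀ x y, ∀ j ≠ i₀, m x y j = y j := fun x y j hj => by simp [m, hej x j hj, he'j y j hj]
  have hm : ∀ x ∈ Set.univ.pi Q, ∀ y ∈ Set.univ.pi Q, m x y ∈ Set.univ.pi Q := by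
    intro x hx y hy j hj
    by_cases h : j = i₀
    · subst h
      rw [hm0]
      exact hx _ hj
    · rw [hmj x y j h]
      exact hy j hj
  have hgm : ∀ x y, g (e x) + (g (e' y) - g q) = g (m x y) := by
    intro x y
    have h1 : g (e x) - g (m x y) = g.linear (q - e' y) := by
      have := g.linearMap_vsub (e x) (m x y)
      simp only [vsub_eq_sub] at this
      rw [← this]
      congr 1
      simp only [m]
      abel
    have h2 : g q - g (e' y) = g.linear (q - e' y) := by
      have := g.linearMap_vsub q (e' y)
      simpa only [vsub_eq_sub] using this.symm
    rw [← h2] at h1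
    rw [← sub_eq_zero] at h1 ⊢
    rw [← h1]
    abel
  have hP : P = A + B := by
    rw [← hg.image_eq]
    ext z
    constructor
    · rintro ⟨x, hx, rfl⟩
      refine ⟨g (e x), ⟨x, hx, rfl⟩, g (e' x) - g q, ⟨x, hx, by simp⟩, ?_⟩
      simp only [hgm]
      congr 1
      funext j
      by_cases h : j = i₀
      · subst h
        rw [hm0]
      · rw [hmj x x j h]
    · rintro ⟨_, ⟨x, hx, rfl⟩, _, ⟨y, hy, rfl⟩, rfl⟩
      exact ⟨m x y, hm x hx y hy, by simp [← hgm]⟩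
  have hqC : q ∈ Set.univ.pi Q := fun i _ => hq i
  have hupd : ∀ (i : Fin k), ∀ z ∈ Q i, Function.update q i z ∈ Set.univ.pi Q := by
    intro i z hz j _
    by_cases h : j = i
    · subst h
      simpa using hz
    · rw [Function.update_of_ne h]
      exact hq j
  have hinj : ∀ x ∈ Set.univ.pi Q, ∀ x' ∈ Set.univ.pi Q, ∀ y ∈ Set.univ.pi Q,
      ∀ y' ∈ Set.univ.pi Q, g (e x) + (g (e' y) - g q) = g (e x') + (g (e' y') - g q) →
        e x = e x' ∧ e' y = e' y' := by
    intro x hx x' hx' y hy y' hy' h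
    rw [hgm, hgm] at h
    have h1 := hg.injOn (hm x hx y hy) (hm x' hx' y' hy') h
    refine ⟨funext fun j => ?_, funext fun j => ?_⟩
    · by_cases hj : j = i₀
      · subst hj
        rw [he0, he0, ← hm0 x y, ← hm0 x' y', h1]
      · rw [hej x j hj, hej x' j hj]
    · by_cases hj : j = i₀
      · subst hj
        rw [he'0, he'0]
      · rw [he'j y j hj, he'j y' j hj, ← hmj x y j hj, ← hmj x' y' j hj, h1]
  rw [hP]
  refine isDecomposable_add (hC.image _) (hC.image _) ?_ ?_ ?_
  · obtain ⟨z, hz, z', hz', hne⟩ := hnt i₀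
    refine ⟨_, ⟨_, hupd i₀ z hz, rfl⟩, _, ⟨_, hupd i₀ z' hz', rfl⟩, fun h => hne ?_⟩
    have := (hinj _ (hupd i₀ z hz) _ (hupd i₀ z' hz') q hqC q hqC
      (congrArg (· + (g (e' q) - g q)) h)).1
    have := congrFun this i₀
    rw [he0, he0] at this
    simpa using this
  · obtain ⟨z, hz, z', hz', hne⟩ := hnt i₁
    refine ⟨_, ⟨_, hupd i₁ z hz, rfl⟩, _, ⟨_, hupd i₁ z' hz', rfl⟩, fun h => hne ?_⟩
    have := (hinj q hqC q hqC _ (hupd i₁ z hz) _ (hupd i₁ z' hz')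
      (congrArg (g (e q) + ·) (by simpa using h))).2
    have := congrFun this i₁
    rw [he'j _ _ hi, he'j _ _ hi] at this
    simpa using this
  · rintro _ ⟨x, hx, rfl⟩ _ ⟨x', hx', rfl⟩ _ ⟨y, hy, rfl⟩ _ ⟨y', hy', rfl⟩ h
    obtain ⟨h1, h2⟩ := hinj x hx x' hx' y hy y' hy' (by simpa using h)
    exact ⟨by simp [h1], by simp [h2]⟩

theorem IsProductOf.isDecomposable {Φ : ∀ m : ℕ, Set (Fin m → ℝ) → Prop}
    (hΦ : ∀ m Q, Φ m Q → IsPolytope Q) {n : ℕ} {P : Set (Fin n → ℝ)} (h : IsProductOf Φ P) :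
    IsDecomposable P := by
  obtain ⟨k, hk, m, Q, hQ, g, hg⟩ := h
  exact isDecomposable_of_bijOn_pi hk (fun i => (hQ i).1) (fun i => hΦ _ _ (hQ i).2) g hg

theorem IsInternalProductOf.isProductOf {Φ : ∀ m : ℕ, Set (Fin m → ℝ) → Prop} {n : ℕ}
    {P : Set (Fin n → ℝ)} (h : IsInternalProductOf (Φ n) P) : IsProductOf Φ P := by
  obtain ⟨k, hk, Q, hQ, hbij⟩ := h
  refine ⟨k, hk, fun _ => n, Q, hQ,
    (∑ i, LinearMap.proj i : (Fin k → Fin n → ℝ) →ₗ[ℝ] (Fin n → ℝ)).toAffineMap, ?_⟩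
  convert hbij using 1
  funext x
  simp

end Products

/-- Decomposability, being a product and being an internal product are equivalent as soon as
decomposability yields an internal product. -/
theorem decomposable_iff_product {Φ : ∀ m : ℕ, Set (Fin m → ℝ) → Prop}
    (hΦ : ∀ m Q, Φ m Q → IsPolytope Q) {n : ℕ} {P : Set (Fin n → ℝ)}
    (h : IsDecomposable P → IsInternalProductOf (Φ n) P) :
    (IsDecomposable P ↔ IsProductOf Φ P) ∧ (IsDecomposable P ↔ IsInternalProductOf (Φ n) P) :=
  ⟨⟨fun hd => (h hd).isProductOf, fun hp => hp.isDecomposable hΦ⟩,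
    ⟨h, fun hi => (IsInternalProductOf.isProductOf (Φ := Φ) hi).isDecomposable hΦ⟩⟩

end Polytope

theorem theorem4p3 (n : ℕ) (P : Set (Fin n → ℝ)) :
    (Polytope.IsTwoLevel P →
      (Polytope.IsDecomposable P ↔
        Polytope.IsProductOf (fun _ Q => Polytope.IsTwoLevel Q) P) ∧
      (Polytope.IsDecomposable P ↔
        Polytope.IsInternalProductOf (fun Q => Polytope.IsTwoLevel Q) P)) ∧
    (Polytope.IsCompressed P →
      (Polytope.IsDecomposable P ↔
        Polytope.IsProductOf (fun _ Q => Polytope.IsCompressed Q) P) ∧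
      (Polytope.IsDecomposable P ↔
        Polytope.IsInternalProductOf (fun Q => Polytope.IsCompressed Q) P)) := by
  refine ⟨fun hP => ?_, fun hP => ?_⟩
  · exact Polytope.decomposable_iff_product (Φ := fun _ Q => Polytope.IsTwoLevel Q)
      (fun _ _ h => h.1) fun hd =>
        hP.isInternalProductOf hd fun π hπ p _ => ⟨hP.factor hπ p p, hP.factor hπ p 0⟩
  · exact Polytope.decomposable_iff_product (Φ := fun _ Q => Polytope.IsCompressed Q)
      (fun _ _ h => h.1.1) fun hd =>
        hP.isTwoLevel.isInternalProductOf hd fun π hπ p hp =>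
          ⟨hP.factor hπ hp (hP.1.2 p hp), hP.factor hπ hp Polytope.isLatticePoint_zero⟩
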